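/- Let $T=(V,E)$ be a finite tree, let each node $i\in V$ hold measurements $X_i\in\{0,1,\ldots,l_i-1\}$ with $l_i\ge 1$, and for $A\subseteq V$ put $l_A:=\sum_{i\in A}(l_i-1)$, the largest possible value of $\sum_{i\in A}X_i$. Let $\theta$ be an integer with $0\le\theta\le l_V+1$, and let $\Pi_\theta(X)=1$ if $\sum_{i\in V}X_i\ge\theta$ and $\Pi_\theta(X)=0$ otherwise. For a block length $N$, node $i$ holds a block $X_i^N$ of $N$ measurements. A strategy $S_N$ is a deterministic interactive protocol with finitely many time slots. In each slot, on each edge, one endpoint sends one bit to the other or neither transmits, and which of these happens is determined by the previous slots on that edge. The bit sent by node $i$ depends on $X_i^N$ and on the previous slots on the edges at $i$. The strategy is correct if for every input every node $i$ can determine all $N$ values of $\Pi_\theta$ from $X_i^N$ and the transmissions on the edges at $i$. Let $C_e(S_N,N)$ be the maximum over all inputs of the total number of bits exchanged, in both directions, on the edge $e$. For an edge $e$, let $A_e$ and $V\setminus A_e$ be the node sets of the two components that remain when $e$ is removed. Then the complexity $C_e(\Pi_\theta):=\lim_{N\to\infty}\min_{S_N}C_e(S_N,N)/N$, the minimum being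 over the correct strategies for block length $N$, exists for every edge $e$ and $$C_e(\Pi_\theta)=\log_2\min\bigl\{\,2\theta+1,\;2\min(l_{A_e},l_{V\setminus A_e})+2,\;2(l_V-\theta+1)+1\,\bigr\}.$$ Moreover, these values are attained on all edges simultaneously: there are correct strategies $S_N^*$, $N\ge 0$, with $\lim_{N\to\infty}C_e(S_N^*,N)/N=C_e(\Pi_\theta)$ for every edge $e$. -/

import Mathlib

open Filter Topology

/-- A block of `N` measurements for every node `v`, each in `{0, …, l v - 1}`. -/
abbrev BlockInput {V : Type*} (l : V → ℕ) (N : ℕ) : Type _ :=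
  (v : V) → Fin N → Fin (l v)

/-- What has happened on one edge so far, slot by slot, oldest slot first:
`none` is a slot in which neither endpoint transmitted,
`some b` is a slot in which one endpoint sent the bit `b` to the other. -/
abbrev EdgeHistory : Type := List (Option Bool)

/-- The edges of `G` incident to the node `v`. -/
abbrev IncidentEdge {V : Type*} (G : SimpleGraph V) (v : V) : Type _ :=
  {e : G.edgeSet // v ∈ e.1}

/-- An interactive deterministic strategy for block length `N` on the network `G`.
Time is divided into finitely many slots. -/
structure Strategy {V : Type*} (G : SimpleGraph V) (l : V → ℕ) (N : ℕ) where
  /-- the number of slots -/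
  slots : ℕ
  /-- Which endpoint of `e`, if any, transmits in the next slot on `e`. It is determined from the
  previous transmissions on `e`, so that both endpoints know it, and silence that depends on
  anything else cannot be used as a free signal. -/
  sched : (e : G.edgeSet) → EdgeHistory → Option {v : V // v ∈ e.1}
  /-- The bit that `v` sends on an incident edge when it is its turn there: a function of the
  measurement block of `v` and of everything that happened on the edges at `v`. -/
  msg : (v : V) → IncidentEdge G v → (Fin N → Fin (l v)) →
    (IncidentEdge G v → EdgeHistory) → Bool
  /-- The function block that `v` decodes from its own measurement block and from everything that
  happened on the edges at `v`. -/
  decode : (v : V) → (Fin N → Fin (l v)) → (IncidentEdge G v → EdgeHistory) → Fin N → Bool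

namespace Strategy

variable {V : Type*} {G : SimpleGraph V} {l : V → ℕ} {N : ℕ}

/-- The histories of all the edges after `t` slots, on input `x`. -/
def history (S : Strategy G l N) (x : BlockInput l N) : ℕ → G.edgeSet → EdgeHistory
  | 0, _ => []
  | t + 1, e =>
      S.history x t e ++
        [(S.sched e (S.history x t e)).map fun v =>
          S.msg v.1 ⟨e, v.2⟩ (x v.1) fun e' => S.history x t e'.1]

/-- The total number of bits exchanged, in both directions, on the edge `e` on input `x`. -/
def bits (S : Strategy G l N) (e : G.edgeSet) (x : BlockInput l N) : ℕ :=
  (S.history x S.slots e).countP Option.isSome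

/-- The worst-case total number of bits exchanged on the edge `e`. -/
def cost [Fintype V] [DecidableEq V] (S : Strategy G l N) (e : G.edgeSet) : ℕ :=
  Finset.univ.sup fun x : BlockInput l N => S.bits e x

/-- Zero-error block computation of `f`: on every input, every node decodes the function block. -/
def Computes (S : Strategy G l N) (f : ((v : V) → Fin (l v)) → Bool) : Prop :=
  ∀ (x : BlockInput l N) (v : V) (k : Fin N),
    S.decode v (x v) (fun e => S.history x S.slots e.1) k = f fun u => x u k

end Strategy

/-- The sum-threshold function `Π_θ`. -/
def sumThreshold {V : Type*} [Fintype V] {l : V → ℕ} (θ : ℕ) (x : (v : V) → Fin (l v)) : Bool :=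
  decide (θ ≤ ∑ v, (x v : ℕ))

/-- The least worst-case number of bits exchanged on the edge `e`, over all strategies for block
length `N` that compute `f` with zero error. -/
noncomputable def minCost {V : Type*} [Fintype V] [DecidableEq V] (G : SimpleGraph V) (l : V → ℕ)
    (f : ((v : V) → Fin (l v)) → Bool) (e : G.edgeSet) (N : ℕ) : ℕ :=
  sInf {c | ∃ S : Strategy G l N, S.Computes f ∧ S.cost e = c}

open scoped Classical in
/-- The set of nodes on the side of `i` when the edge `ij` is removed from `G`. -/
noncomputable def edgeSide {V : Type*} [Fintype V] (G : SimpleGraph V) (i j : V) : Finset V :=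
  Finset.univ.filter fun v => (G.deleteEdges {s(i, j)}).Reachable i v

/-- The largest possible sum of the measurements of the nodes in `A`. -/
def maxSum {V : Type*} (l : V → ℕ) (A : Finset V) : ℕ :=
  ∑ v ∈ A, (l v - 1)

/-- `log₂ min (2θ + 1, 2 min (l_A, l_{V∖A}) + 2, 2 (l_V - θ + 1) + 1)`. -/
noncomputable def thresholdRate {V : Type*} [Fintype V] [DecidableEq V] (l : V → ℕ) (θ : ℕ)
    (A : Finset V) : ℝ :=
  Real.logb 2
    (min (2 * (θ : ℝ) + 1)
      (min (2 * min (maxSum l A : ℝ) (maxSum l Aᶜ : ℝ) + 2)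
        (2 * ((maxSum l Finset.univ : ℝ) - (θ : ℝ) + 1) + 1)))

/-! ### Rooting a tree and the two sides of an edge -/

section Tree

variable {V : Type*} {G : SimpleGraph V}

/-! Fix an edge whose sides have maximal partial sums `a` and `b`. Both bounds on its cost meet at
`M ^ N`, with `M = outcomes θ a b`.

Lower bound: the pairs of partial sums with total `θ` or `θ - 1` form a fooling set of at least `M`
elements. If two block inputs built from such pairs had the same history on the edge, the input
taking one side from each would look to either side like an input it belongs to. All values of the
function would then agree, which forces the pairs to coincide (`eq_of_mem_foolingSet`). Distinct
histories carry prefix-incomparable bit strings, so `M ^ N ≤ 2 ^ cost` (`Strategy.outcomes_pow_le`).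

Upper bound: root the tree. Each node sends its parent the block of truncated partial sums below it,
and the parent replies with one bit for each position that these leave undecided. A block with `u`
undecided positions gets a codeword shorter by `u` bits, so codeword and reply together have
constant length. Such a prefix code exists by a Kraft-type inequality: the sum of `2 ^ u` over all
blocks factors over positions and equals `M ^ N` (`Rooting.sum_two_pow_undecided`). The overhead is
logarithmic in `N` and vanishes in the limit. One strategy does this on all edges at once, hence
simultaneous optimality. -/

lemma SimpleGraph.Walk.reachable_deleteEdges_endpoint_or {i j u : V} (p : G.Walk u i) :
    (G.deleteEdges {s(i, j)}).Reachable i u ∨ (G.deleteEdges {s(i, j)}).Reachable j u := by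
  induction p with
  | nil => exact Or.inl (SimpleGraph.Reachable.refl _)
  | @cons a b c hab p ih =>
    by_cases h : s(a, b) = s(c, j)
    · rcases Sym2.eq_iff.1 h with ⟨rfl, -⟩ | ⟨rfl, -⟩
      · exact Or.inl (SimpleGraph.Reachable.refl _)
      · exact Or.inr (SimpleGraph.Reachable.refl _)
    · have hba : (G.deleteEdges {s(c, j)}).Adj b a := by
        rw [SimpleGraph.deleteEdges_adj]
        refine ⟨hab.symm, ?_⟩
        rwa [Set.mem_singleton_iff, Sym2.eq_swap]
      exact ih.imp (·.trans hba.reachable) (·.trans hba.reachable)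

variable [Fintype V]

lemma mem_edgeSide {i j u : V} :
    u ∈ edgeSide G i j ↔ (G.deleteEdges {s(i, j)}).Reachable i u := by
  classical
  simp [edgeSide]

lemma left_mem_edgeSide (i j : V) : i ∈ edgeSide G i j :=
  mem_edgeSide.2 (SimpleGraph.Reachable.refl _)

variable (hG : G.IsTree)
include hG

omit [Fintype V] in
lemma not_reachable_deleteEdges {i j : V} (h : G.Adj i j) :
    ¬ (G.deleteEdges {s(i, j)}).Reachable i j := by
  have := SimpleGraph.isAcyclic_iff_forall_isBridge.1 hG.isAcyclic
    (show s(i, j) ∈ G.edgeSet from h)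
  exact SimpleGraph.isBridge_iff.1 this

lemma right_notMem_edgeSide {i j : V} (h : G.Adj i j) : j ∉ edgeSide G i j :=
  fun hj => not_reachable_deleteEdges hG h (mem_edgeSide.1 hj)

lemma edgeSide_swap [DecidableEq V] {i j : V} (h : G.Adj i j) :
    edgeSide G j i = (edgeSide G i j)ᶜ := by
  ext u
  rw [Finset.mem_compl, mem_edgeSide, mem_edgeSide, Sym2.eq_swap]
  constructor
  · exact fun hj hi => not_reachable_deleteEdges hG h (hi.trans hj.symm)
  · obtain ⟨p⟩ := hG.connected.preconnected u i
    exact (p.reachable_deleteEdges_endpoint_or (j := j)).resolve_left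

lemma exists_isPath_of_mem_edgeSide {c v u : V} (h : G.Adj c v) (hu : u ∈ edgeSide G c v) :
    ∃ q : G.Walk c u, q.IsPath ∧ v ∉ q.support := by
  classical
  obtain ⟨p, hp⟩ := SimpleGraph.reachable_deleteEdges_iff_exists_walk.1 (mem_edgeSide.1 hu)
  refine ⟨p.bypass, p.bypass_isPath, fun hv => not_reachable_deleteEdges hG h ?_⟩
  refine SimpleGraph.reachable_deleteEdges_iff_exists_walk.2 ⟨p.bypass.takeUntil v hv, fun he => ?_⟩
  exact hp (p.edges_bypass_subset_edges (p.bypass.edges_takeUntil_subset_edges hv he))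

/-- Prefixing `v` to paths that avoid it gives two paths from `v` to `u`; in a tree they are equal,
so their first steps agree. -/
lemma eq_of_mem_edgeSide {c c' v u : V} (h : G.Adj c v) (h' : G.Adj c' v)
    (hu : u ∈ edgeSide G c v) (hu' : u ∈ edgeSide G c' v) : c = c' := by
  obtain ⟨q, hq, hv⟩ := exists_isPath_of_mem_edgeSide hG h hu
  obtain ⟨q', hq', hv'⟩ := exists_isPath_of_mem_edgeSide hG h' hu'
  have := (hG.existsUnique_path v u).unique
    (hq.cons (h := h.symm) hv) (hq'.cons (h := h'.symm) hv')
  injection this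

lemma exists_mem_edgeSide {v u : V} (huv : u ≠ v) : ∃ c, G.Adj c v ∧ u ∈ edgeSide G c v := by
  obtain ⟨p, hp, -⟩ := hG.existsUnique_path v u
  cases p with
  | nil => exact absurd rfl huv
  | @cons _ c _ hc q =>
    rw [SimpleGraph.Walk.cons_isPath_iff] at hp
    exact ⟨c, hc.symm, mem_edgeSide.2 (SimpleGraph.reachable_deleteEdges_iff_exists_walk.2
      ⟨q, fun he => hp.2 (q.snd_mem_support_of_mem_edges he)⟩)⟩

omit hG

/-- A tree in which every node `v` other than `root` has the edge `v — parent v`, and `below v` is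
the set of nodes on the side of `v` of this edge. -/
structure Rooting [DecidableEq V] (G : SimpleGraph V) where
  /-- the root -/
  root : V
  /-- the neighbour in the direction of the root -/
  parent : V → V
  /-- the nodes that are cut off from the root by `v`, and `v` itself -/
  below : V → Finset V
  adj : ∀ v, v ≠ root → G.Adj v (parent v)
  below_root : below root = Finset.univ
  below_eq : ∀ v, v ≠ root → below v = edgeSide G v (parent v)
  exists_child : ∀ e : G.edgeSet, ∃ v, v ≠ root ∧ e.1 = s(v, parent v)
  child_unique : ∀ v w, v ≠ root → w ≠ root → s(v, parent v) = s(w, parent w) → v = w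
  sum_below : ∀ (g : V → ℕ) (v : V), ∑ u ∈ below v, g u =
    g v + ∑ c with c ≠ root ∧ parent c = v, ∑ u ∈ below c, g u

-- The parent of `v` is the neighbour whose side contains the root. Every other neighbour is a
-- child, and the sides of the children partition what lies strictly below `v`.
include hG in
lemma nonempty_rooting [DecidableEq V] : Nonempty (Rooting G) := by
  obtain ⟨r⟩ := hG.connected.nonempty
  choose! p hp using fun v (hv : v ≠ r) => exists_mem_edgeSide hG hv.symm
  have hpar : ∀ v c, G.Adj c v → (v ≠ r → c ≠ p v) → c ≠ r ∧ p c = v := by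
    intro v c hc h
    have hr : r ∉ edgeSide G c v := by
      intro hr
      by_cases hv : v = r
      · subst hv
        exact right_notMem_edgeSide hG hc hr
      · exact h hv (eq_of_mem_edgeSide hG hc (hp v hv).1 hr (hp v hv).2)
    have hcr : c ≠ r := by
      rintro rfl
      exact hr (left_mem_edgeSide _ _)
    refine ⟨hcr, eq_of_mem_edgeSide hG (hp c hcr).1 hc.symm (hp c hcr).2 ?_⟩
    rw [edgeSide_swap hG hc]
    exact Finset.mem_compl.2 hr
  -- No edge is a parent edge from both ends: the root would lie on both of its sides.
  have hadj : ∀ c, c ≠ r → (p c ≠ r → c ≠ p (p c)) := by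
    intro c hc hpc h
    have h1 := (hp c hc).2
    have h2 := (hp _ hpc).2
    rw [← h, edgeSide_swap hG (hp c hc).1] at h2
    exact Finset.mem_compl.1 h2 h1
  have hmem : ∀ v u c, (u ∈ edgeSide G c v ∧ (c ≠ r ∧ p c = v) →
      (v ≠ r → u ∉ edgeSide G (p v) v)) := by
    rintro v u c ⟨hu, hc, rfl⟩ hv hu'
    exact hadj c hc hv (eq_of_mem_edgeSide hG (hp c hc).1.symm (hp _ hv).1 hu hu')
  set B : V → Finset V := fun v => if v = r then Finset.univ else edgeSide G v (p v) with hB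
  have hBne : ∀ v, v ≠ r → B v = edgeSide G v (p v) := fun v hv => by simp [hB, hv]
  have hmemB : ∀ v u, u ∈ B v ↔ (v ≠ r → u ∉ edgeSide G (p v) v) := by
    intro v u
    by_cases hv : v = r
    · simp [hB, hv]
    · rw [hBne v hv, edgeSide_swap hG (hp v hv).1, Finset.mem_compl]
      simp [hv]
  refine ⟨⟨r, p, B, fun v hv => (hp v hv).1.symm, by simp [hB], hBne, ?_, ?_, ?_⟩⟩
  · rintro ⟨e, he⟩
    induction e with | h a b =>
    by_cases h : b ≠ r → a ≠ p b
    · obtain ⟨h1, h2⟩ := hpar b a he h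
      exact ⟨a, h1, by rw [h2]⟩
    · push Not at h
      exact ⟨b, h.1, by rw [← h.2]; exact Sym2.eq_swap⟩
  · intro v w hv hw h
    rcases Sym2.eq_iff.1 h with ⟨h, -⟩ | ⟨h1, h2⟩
    · exact h
    · subst h2
      exact absurd h1 (hadj v hv hw)
  · intro g v
    have hpart : B v = insert v
        ((Finset.univ.filter fun c => c ≠ r ∧ p c = v).biUnion B) := by
      ext u
      rw [Finset.mem_insert, Finset.mem_biUnion]
      constructor
      · intro hu
        by_cases huv : u = v
        · exact Or.inl huv
        · obtain ⟨c, hc, huc⟩ := exists_mem_edgeSide hG huv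
          have := hpar v c hc fun hv h => (hmemB v u).1 hu hv (h ▸ huc)
          refine Or.inr ⟨c, by simpa using this, ?_⟩
          rwa [hBne c this.1, this.2]
      · rintro (rfl | ⟨c, hc, hu⟩)
        · exact (hmemB u u).2 fun hv => right_notMem_edgeSide hG (hp u hv).1
        · simp only [Finset.mem_filter, Finset.mem_univ, true_and] at hc
          rw [hBne c hc.1, hc.2] at hu
          exact (hmemB v u).2 (hmem v u c ⟨hu, hc⟩)
    rw [hpart, Finset.sum_insert, Finset.sum_biUnion]
    · intro c hc c' hc' hne
      simp only [Finset.coe_filter, Finset.mem_univ, true_and, Set.mem_ofPred_eq] at hc hc'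
      rw [Function.onFun, Finset.disjoint_left]
      intro u hu hu'
      rw [hBne c hc.1, hc.2] at hu
      rw [hBne c' hc'.1, hc'.2] at hu'
      have h1 := (hp c hc.1).1.symm
      have h2 := (hp c' hc'.1).1.symm
      rw [hc.2] at h1
      rw [hc'.2] at h2
      exact hne (eq_of_mem_edgeSide hG h1 h2 hu hu')
    · simp only [Finset.mem_biUnion, Finset.mem_filter, Finset.mem_univ, true_and, not_exists,
        not_and]
      intro c hc hv
      have h1 := (hp c hc.1).1.symm
      rw [hBne c hc.1] at hv
      rw [hc.2] at h1 hv
      exact right_notMem_edgeSide hG h1 hv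

end Tree

/-! ### Transcripts on an edge: prefix-freeness and cut-and-paste -/

section Histories

namespace Strategy

variable {V : Type*} {G : SimpleGraph V} {l : V → ℕ} {N : ℕ}

lemma history_succ (S : Strategy G l N) (x : BlockInput l N) (t : ℕ) (e : G.edgeSet) :
    S.history x (t + 1) e = S.history x t e ++
      [(S.sched e (S.history x t e)).map fun v =>
        S.msg v.1 ⟨e, v.2⟩ (x v.1) fun e' => S.history x t e'.1] := rfl

lemma length_history (S : Strategy G l N) (x : BlockInput l N) (t : ℕ) (e : G.edgeSet) :
    (S.history x t e).length = t := by
  induction t with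
  | zero => rfl
  | succ t ih => rw [history_succ, List.length_append, ih]; rfl

lemma bits_eq (S : Strategy G l N) (e : G.edgeSet) (x : BlockInput l N) :
    S.bits e x = (S.history x S.slots e).reduceOption.length := by
  rw [bits, List.reduceOption_length_eq, List.countP_eq_length_filter]

lemma history_eq_of_le (S : Strategy G l N) {x y : BlockInput l N} {e : G.edgeSet} {s t : ℕ}
    (hst : s ≤ t) (h : S.history x t e = S.history y t e) :
    S.history x s e = S.history y s e := by
  induction t, hst using Nat.le_induction with
  | base => exact h
  | succ t _ ih =>
    rw [history_succ, history_succ] at h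
    exact ih (List.append_inj_left' h rfl)

/-- The bit strings sent over an edge form a prefix-free set and determine the history. -/
lemma history_eq_of_prefix (S : Strategy G l N) {x y : BlockInput l N} {e : G.edgeSet} (t : ℕ)
    {r : List Bool} (hx : (S.history x t e).reduceOption <+: r)
    (hy : (S.history y t e).reduceOption <+: r) :
    S.history x t e = S.history y t e := by
  induction t with
  | zero => rfl
  | succ t ih =>
    rw [history_succ, List.reduceOption_append] at hx hy
    have h := ih ((List.prefix_append _ _).trans hx) ((List.prefix_append _ _).trans hy)
    rw [history_succ, history_succ]
    rw [h] at hx ⊢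
    rcases hs : S.sched e (S.history y t e) with _ | v
    · rfl
    · rw [hs] at hx hy
      simp only [Option.map_some, List.reduceOption_singleton, Option.toList_some] at hx hy ⊢
      have := List.prefix_or_prefix_of_prefix hx hy
      have heq := this.elim (fun h => h.eq_of_length (by simp))
        fun h => (h.eq_of_length (by simp)).symm
      have := List.append_cancel_left heq
      simp only [List.cons.injEq, and_true] at this
      rw [this]

/-- Cut-and-paste: only `e` joins `A` to its complement, and there the two runs agree, so each node
sees exactly the run of the input from which its own block is taken. -/
lemma history_hybrid (S : Strategy G l N) (A : V → Prop) [DecidablePred A] {e : G.edgeSet}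
    (hA : ∀ e' : G.edgeSet, ∀ v ∈ e'.1, ∀ w ∈ e'.1, A v → ¬ A w → e' = e)
    {x y : BlockInput l N} {t : ℕ} (h : S.history x t e = S.history y t e) (v : V)
    (e' : G.edgeSet) (hv : v ∈ e'.1) :
    S.history (fun u => if A u then x u else y u) t e' =
      S.history (if A v then x else y) t e' := by
  induction t generalizing v e' with
  | zero => rfl
  | succ t ih =>
    have ih := ih (S.history_eq_of_le t.le_succ h)
    -- The new slot is governed by its sender `w`. If `v` and `w` lie on opposite sides, the edge is
    -- `e` and the two runs agree on it.
    obtain ⟨w, hw, hwe⟩ : ∃ w ∈ e'.1,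
        S.history (fun u => if A u then x u else y u) (t + 1) e' =
          S.history (if A w then x else y) (t + 1) e' := by
      rw [history_succ]
      rcases hs : S.sched e' (S.history (fun u => if A u then x u else y u) t e') with _ | w
      · refine ⟨v, hv, ?_⟩
        rw [history_succ, ← ih v e' hv, hs]
        rfl
      · refine ⟨w.1, w.2, ?_⟩
        rw [history_succ, ← ih w.1 e' w.2, hs]
        simp only [Option.map_some]
        congr 4
        · by_cases hw : A w.1 <;> simp [hw]
        · funext e''
          exact ih w.1 e''.1 e''.2
    rw [hwe]
    by_cases h1 : A v <;> by_cases h2 : A w <;> simp only [h1, h2, if_true, if_false]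
    · rw [hA e' v hv w hw h1 h2, h]
    · rw [hA e' w hw v hv h2 h1, h]

/-- On the hybrid, `i` decodes as on `x` and `j` as on `y`, yet both must output the value of the
hybrid. -/
lemma computes_hybrid (S : Strategy G l N) {f : ((v : V) → Fin (l v)) → Bool}
    (hS : S.Computes f) (A : V → Prop) [DecidablePred A] {i j : V} (hi : A i) (hj : ¬ A j)
    {e : G.edgeSet}
    (hA : ∀ e' : G.edgeSet, ∀ v ∈ e'.1, ∀ w ∈ e'.1, A v → ¬ A w → e' = e)
    {x y : BlockInput l N} (h : S.history x S.slots e = S.history y S.slots e) (k : Fin N) :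
    f (fun u => x u k) = f (fun u => (if A u then x u else y u) k) ∧
      f (fun u => y u k) = f (fun u => (if A u then x u else y u) k) := by
  constructor
  · rw [← hS x i k, ← hS _ i k]
    congr 1
    · simp [hi]
    · funext e'
      rw [S.history_hybrid A hA h i e'.1 e'.2]
      simp [hi]
  · rw [← hS y j k, ← hS _ j k]
    congr 1
    · simp [hj]
    · funext e'
      rw [S.history_hybrid A hA h j e'.1 e'.2]
      simp [hj]

lemma bits_le_cost [Fintype V] [DecidableEq V] (S : Strategy G l N) (e : G.edgeSet)
    (x : BlockInput l N) : S.bits e x ≤ S.cost e :=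
  Finset.le_sup (f := fun x => S.bits e x) (Finset.mem_univ x)

/-- Inputs with pairwise different histories on `e` number at most `2 ^ cost`. -/
lemma card_le_two_pow_cost [Fintype V] [DecidableEq V] (S : Strategy G l N) (e : G.edgeSet)
    {ι : Type*} [Fintype ι] (x : ι → BlockInput l N)
    (hx : ∀ a b, S.history (x a) S.slots e = S.history (x b) S.slots e → a = b) :
    Fintype.card ι ≤ 2 ^ S.cost e := by
  have hle : ∀ a, (S.history (x a) S.slots e).reduceOption.length ≤ S.cost e :=
    fun a => (S.bits_eq e (x a)).symm.trans_le (S.bits_le_cost e (x a))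
  -- Padding to a common length stays injective because two transcripts that are prefixes of one
  -- word come from equal histories.
  let pad : ι → List.Vector Bool (S.cost e) := fun a =>
    ⟨(S.history (x a) S.slots e).reduceOption ++
      List.replicate (S.cost e - (S.history (x a) S.slots e).reduceOption.length) false, by
        have := hle a
        simp only [List.length_append, List.length_replicate]
        omega⟩
  have hpad : Function.Injective pad := fun a b hab => by
    refine hx a b (S.history_eq_of_prefix S.slots (r := (pad a).1) (List.prefix_append _ _) ?_)
    rw [hab]
    exact List.prefix_append _ _
  simpa [card_vector] using Fintype.card_le_of_injective pad hpad

end Strategy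

end Histories

/-! ### Composing strategies message by message -/

section Realizable

variable {V : Type*} {G : SimpleGraph V} {l : V → ℕ} {N : ℕ}

/-- Some strategy sends exactly the bits `T e x` over every edge `e` on every input `x`. -/
def Realizable (T : G.edgeSet → BlockInput l N → List Bool) : Prop :=
  ∃ S : Strategy G l N, ∀ e x, (S.history x S.slots e).reduceOption = T e x

lemma realizable_nil : Realizable (fun (_ : G.edgeSet) (_ : BlockInput l N) => []) :=
  ⟨⟨0, fun _ _ => none, fun _ _ _ _ => false, fun _ _ _ _ => false⟩, fun _ _ => rfl⟩

/-- `hknown` says that the sender can compute the message. `hprefix` says that, given the earlier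
bits on `e`, the possible messages are prefix-free, so both endpoints see when it ends and the
schedule depends on the edge history alone. -/
lemma Realizable.append_message [Fintype V] [DecidableEq V] [DecidableEq G.edgeSet]
    {T : G.edgeSet → BlockInput l N → List Bool} (hT : Realizable T) (e : G.edgeSet) {v : V}
    (hv : v ∈ e.1) (φ : BlockInput l N → List Bool)
    (hknown : ∀ x y, x v = y v → (∀ e' : G.edgeSet, v ∈ e'.1 → T e' x = T e' y) → φ x = φ y)
    (hprefix : ∀ x y, T e x = T e y → φ x <+: φ y → φ x = φ y) :
    Realizable (Function.update T e fun x => T e x ++ φ x) := by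
  classical
  obtain ⟨S, hS⟩ := hT
  set n := S.slots with hn
  obtain ⟨g, hg⟩ : ∃ g : (Fin N → Fin (l v)) → (IncidentEdge G v → EdgeHistory) → List Bool,
      ∀ x, g (x v) (fun e' => S.history x n e'.1) = φ x := by
    refine ⟨fun X H => if h : ∃ x : BlockInput l N, x v = X ∧
      (fun e' : IncidentEdge G v => S.history x n e'.1) = H then φ h.choose else [], fun x => ?_⟩
    have h : ∃ y : BlockInput l N, y v = x v ∧
      (fun e' : IncidentEdge G v => S.history y n e'.1) = fun e' => S.history x n e'.1 :=
      ⟨x, rfl, rfl⟩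
    simp only [dif_pos h]
    refine hknown _ _ h.choose_spec.1 fun e' he' => ?_
    rw [← hS, ← hS]
    exact congrArg _ (congrFun h.choose_spec.2 ⟨e', he'⟩)
  -- The bits since slot `n` already form a complete message compatible with the earlier history of
  -- `e`.
  let done : EdgeHistory → Prop := fun h =>
    ∃ x, S.history x n e = h.take n ∧ φ x = (h.drop n).reduceOption
  let S' : Strategy G l N :=
    { slots := n + Finset.univ.sup fun x => (φ x).length
      sched := fun e' h => if h.length < n then S.sched e' h else
        if he : e' = e ∧ ¬ done h then some ⟨v, he.1 ▸ hv⟩ else none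
      msg := fun u e' X H => if (H e').length < n then S.msg u e' X H else
        if hu : u = v then
          (g (hu ▸ X) fun e'' => (H ⟨e''.1, hu ▸ e''.2⟩).take n).getD
            ((H e').drop n).reduceOption.length false
        else false
      decode := S.decode }
  have hearly : ∀ x t, t ≤ n → S'.history x t = S.history x t := by
    intro x t
    induction t with
    | zero => intro _; rfl
    | succ t ih =>
      intro ht
      have ih := ih (by omega)
      funext e'
      rw [Strategy.history_succ, Strategy.history_succ, ih]
      have hlt : ∀ e', (S.history x t e').length < n := fun e' => by
        rw [Strategy.length_history]; omega
      simp only [S', hlt, if_true]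
  have hlate : ∀ x t e', ∃ B, S'.history x (n + t) e' = S.history x n e' ++ B ∧
      B.reduceOption = if e' = e then (φ x).take t else [] := by
    intro x t
    induction t with
    | zero => exact fun e' => ⟨[], by simp [hearly x n le_rfl], by simp⟩
    | succ t ih =>
      intro e'
      obtain ⟨B, hB, hB'⟩ := ih e'
      rw [← add_assoc, Strategy.history_succ]
      have hlen : ∀ e', ¬ (S'.history x (n + t) e').length < n := fun e' => by
        rw [Strategy.length_history]; omega
      have hnlen : ∀ e', (S.history x n e').length = n := fun e' => S.length_history x n e'
      have htake : ∀ e', (S'.history x (n + t) e').take n = S.history x n e' := fun e' => by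
        obtain ⟨B, hB, -⟩ := ih e'
        rw [hB, List.take_left' (hnlen e')]
      have hdrop : (S'.history x (n + t) e').drop n = B := by
        rw [hB, List.drop_left' (hnlen e')]
      have hsched : S'.sched e' (S'.history x (n + t) e') =
          if he : e' = e ∧ ¬ done (S'.history x (n + t) e') then some ⟨v, he.1 ▸ hv⟩ else none :=
        if_neg (hlen e')
      rw [hsched]
      by_cases he : e' = e
      · subst he
        rw [if_pos rfl] at hB'
        by_cases hd : done (S'.history x (n + t) e')
        · refine ⟨B ++ [none], ?_, ?_⟩
          · rw [dif_neg fun h => h.2 hd, hB]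
            simp
          · obtain ⟨y, hy, hy'⟩ := hd
            rw [htake] at hy
            rw [hdrop, hB'] at hy'
            have hyx : φ y = φ x := hprefix y x (by rw [← hS, ← hS, hy])
              (hy' ▸ List.take_prefix _ _)
            have hl : (φ x).length ≤ t := by
              rw [hyx] at hy'
              have := congrArg List.length hy'
              rw [List.length_take] at this
              omega
            rw [if_pos rfl, List.reduceOption_append, hB', List.take_of_length_le hl,
              List.take_of_length_le (by omega)]
            simp
        · have hl : t < (φ x).length := by
            by_contra hl
            refine hd ⟨x, (htake e').symm, ?_⟩
            rw [hdrop, hB', List.take_of_length_le (by omega)]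
          refine ⟨B ++ [some (φ x)[t]], ?_, ?_⟩
          · rw [dif_pos ⟨rfl, hd⟩, ← List.append_assoc, ← hB, Option.map_some]
            have : S'.msg v ⟨e', hv⟩ (x v) (fun e' => S'.history x (n + t) e'.1) =
                (g (x v) fun e'' => (S'.history x (n + t) e''.1).take n).getD
                  ((S'.history x (n + t) e').drop n).reduceOption.length false := by
              simp only [S', dif_pos]
              rw [if_neg (hlen e')]
            rw [this]
            simp only [htake]
            rw [hg, hdrop, hB', List.length_take, min_eq_left hl.le]
            simp [hl]
          · rw [if_pos rfl, List.reduceOption_append, hB', List.reduceOption_singleton]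
            exact (List.take_succ_eq_append_getElem hl).symm
      · refine ⟨B ++ [none], ?_, ?_⟩
        · simp [he, hB]
        · rw [List.reduceOption_append, hB']
          simp [he]
  refine ⟨S', fun e' x => ?_⟩
  obtain ⟨B, hB, hB'⟩ := hlate x (Finset.univ.sup fun x => (φ x).length) e'
  rw [show S'.slots = n + Finset.univ.sup fun x => (φ x).length from rfl, hB,
    List.reduceOption_append, hS, hB']
  by_cases he : e' = e
  · subst he
    rw [if_pos rfl, Function.update_self, List.take_of_length_le]
    exact Finset.le_sup (f := fun x => (φ x).length) (Finset.mem_univ x)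
  · rw [if_neg he, Function.update_of_ne he, List.append_nil]

/-- If every node can determine `f` from what `T` sends on its edges, then `f` can be computed
with these transmissions. -/
lemma Realizable.exists_computes {T : G.edgeSet → BlockInput l N → List Bool}
    (hT : Realizable T) {f : ((v : V) → Fin (l v)) → Bool}
    (hf : ∀ x y v, x v = y v → (∀ e' : G.edgeSet, v ∈ e'.1 → T e' x = T e' y) →
      ∀ k, f (fun u => x u k) = f (fun u => y u k)) :
    ∃ S : Strategy G l N, S.Computes f ∧ ∀ e x, S.bits e x = (T e x).length := by
  classical
  obtain ⟨S, hS⟩ := hT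
  let S' : Strategy G l N :=
    { S with
      decode := fun v X H k => if h : ∃ x : BlockInput l N, x v = X ∧
        (fun e' : IncidentEdge G v => S.history x S.slots e'.1) = H
        then f fun u => h.choose u k else false }
  have hist : ∀ x t, S'.history x t = S.history x t := by
    intro x t
    induction t with
    | zero => rfl
    | succ t ih =>
      funext e'
      rw [Strategy.history_succ, Strategy.history_succ, ih]
  refine ⟨S', fun x v k => ?_, fun e x => ?_⟩
  · have h : ∃ y : BlockInput l N, y v = x v ∧
      (fun e' : IncidentEdge G v => S.history y S.slots e'.1) =
        fun e' => S'.history x S'.slots e'.1 := ⟨x, rfl, by rw [hist]⟩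
    have hd : S'.decode v (x v) (fun e => S'.history x S'.slots e.1) k =
        f fun u => h.choose u k := dif_pos h
    rw [hd]
    refine hf _ _ v h.choose_spec.1 (fun e' he' => ?_) k
    rw [← hS, ← hS]
    have := congrFun h.choose_spec.2 ⟨e', he'⟩
    exact congrArg _ (this.trans (congrFun (hist _ _) _))
  · rw [Strategy.bits_eq, hist]
    exact congrArg _ (hS e x)

end Realizable

/-! ### A prefix code with prescribed savings -/

section Code

lemma Finset.exists_injOn_bits {α : Type*} (s : Finset α) {k : ℕ} (hs : s.card ≤ 2 ^ k) :
    ∃ f : α → List Bool, (∀ a ∈ s, (f a).length = k) ∧ ∀ a ∈ s, ∀ b ∈ s, f a = f b → a = b := by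
  classical
  obtain ⟨f⟩ : Nonempty (s ↪ List.Vector Bool k) :=
    Function.Embedding.nonempty_of_card_le (by simpa [card_vector] using hs)
  refine ⟨fun a => if h : a ∈ s then (f ⟨a, h⟩).toList else [], fun a ha => ?_, fun a ha b hb hab => ?_⟩
  · simp only [dif_pos ha]
    exact List.Vector.toList_length _
  · simp only [dif_pos ha, dif_pos hb] at hab
    simpa using f.injective (List.Vector.toList_injective hab)

/-- A prefix code in which `a` saves `u a` bits, up to an overhead of `m` bits. -/
lemma Finset.exists_prefix_code {α : Type*} (s : Finset α) (u : α → ℕ) {K m : ℕ}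
    (hu : ∀ a ∈ s, u a < 2 ^ m) (hs : ∑ a ∈ s, 2 ^ u a ≤ 2 ^ K) :
    ∃ enc : α → List Bool, (∀ a ∈ s, (enc a).length + u a = m + K) ∧
      ∀ a ∈ s, ∀ b ∈ s, enc a <+: enc b → a = b := by
  classical
  obtain ⟨hd, hdl, hdi⟩ := (Finset.range (2 ^ m)).exists_injOn_bits (k := m) (by simp)
  have hle : ∀ a ∈ s, u a ≤ K := fun a ha =>
    (Nat.pow_le_pow_iff_right one_lt_two).1
      ((Finset.single_le_sum (f := fun a => 2 ^ u a) (fun _ _ => Nat.zero_le _) ha).trans hs)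
  -- The codeword of `a` will be an `m`-bit header naming `u a`, then an index of `K - u a` bits
  -- within the class of that value. The bound on the sum leaves at most `2 ^ (K - j)` elements in
  -- class `j`.
  have hidx : ∀ j, ∃ f : α → List Bool, (∀ a ∈ s, u a = j → (f a).length = K - j) ∧
      ∀ a ∈ s, ∀ b ∈ s, u a = j → u b = j → f a = f b → a = b := by
    intro j
    by_cases hj : j ≤ K
    · have hcard : (s.filter fun a => u a = j).card ≤ 2 ^ (K - j) := by
        refine Nat.le_of_mul_le_mul_right ?_ (Nat.two_pow_pos j)
        rw [← pow_add, Nat.sub_add_cancel hj]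
        refine le_trans ?_ hs
        rw [← smul_eq_mul, ← Finset.sum_const]
        calc ∑ _a ∈ s.filter (fun a => u a = j), 2 ^ j
            = ∑ a ∈ s.filter (fun a => u a = j), 2 ^ u a :=
              Finset.sum_congr rfl fun a ha => by rw [(Finset.mem_filter.1 ha).2]
          _ ≤ _ := Finset.sum_le_sum_of_subset (Finset.filter_subset _ _)
      obtain ⟨f, hf, hf'⟩ := Finset.exists_injOn_bits _ hcard
      exact ⟨f, fun a ha hj => hf a (Finset.mem_filter.2 ⟨ha, hj⟩), fun a ha b hb hja hjb =>
        hf' a (Finset.mem_filter.2 ⟨ha, hja⟩) b (Finset.mem_filter.2 ⟨hb, hjb⟩)⟩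
    · exact ⟨fun _ => [], fun a ha h => absurd (h ▸ hle a ha) hj,
        fun a ha _ _ h => absurd (h ▸ hle a ha) hj⟩
  choose idx hidl hidi using hidx
  have hhd : ∀ a ∈ s, (hd (u a)).length = m := fun a ha => hdl _ (Finset.mem_range.2 (hu a ha))
  refine ⟨fun a => hd (u a) ++ idx (u a) a, fun a ha => ?_, fun a ha b hb hab => ?_⟩
  · rw [List.length_append, hhd a ha, hidl _ a ha rfl]
    have := hle a ha
    omega
  · have h1 : hd (u a) = hd (u b) := by
      have h := List.prefix_or_prefix_of_prefix ((List.prefix_append _ _).trans hab)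
        (List.prefix_append (hd (u b)) _)
      have hl := (hhd a ha).trans (hhd b hb).symm
      exact h.elim (fun h => h.eq_of_length hl) fun h => (h.eq_of_length hl.symm).symm
    have h2 : u a = u b :=
      hdi _ (Finset.mem_range.2 (hu a ha)) _ (Finset.mem_range.2 (hu b hb)) h1
    have h3 := hab.eq_of_length (by
      simp only [List.length_append, hhd b hb, hidl _ b hb rfl, hidl _ a ha h2, h2])
    simp only [h2] at h3
    exact hidi _ a ha b hb h2 rfl (List.append_cancel_left h3)

end Code

/-! ### The lower bound by a fooling set -/

section Fooling

/-- The number of joint outcomes that matter on an edge whose two sides have partial sums at most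
`a` and `b`: the number of truncated partial sums on the first side plus the number of those that
leave the threshold function undecided. -/
def outcomes (θ a b : ℕ) : ℕ :=
  (Finset.Icc (θ - (b + 1)) (min θ a)).card + (Finset.Ico (θ - b) (min θ (a + 1))).card

/-- The three terms correspond to `θ` being at most both of `a` and `b`, between them, or above
both. The right side is symmetric in `a` and `b`, so the orientation of an edge will not matter. -/
lemma outcomes_eq {θ a b : ℕ} (h : θ ≤ a + b + 1) :
    outcomes θ a b = min (2 * θ + 1) (min (2 * min a b + 2) (2 * (a + b + 1 - θ) + 1)) := by
  simp only [outcomes, Nat.card_Icc, Nat.card_Ico]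
  omega

lemma outcomes_pos {θ a b : ℕ} (h : θ ≤ a + b + 1) : 0 < outcomes θ a b := by
  rw [outcomes_eq h]
  omega

/-- The pairs of partial sums with total `θ` or `θ - 1`. -/
def foolingSet (θ a b : ℕ) : Finset (ℕ × ℕ) :=
  (Finset.range (a + 1) ×ˢ Finset.range (b + 1)).filter fun p => p.1 + p.2 = θ ∨ p.1 + p.2 + 1 = θ

lemma outcomes_le_card_foolingSet {θ a b : ℕ} (h : θ ≤ a + b + 1) :
    outcomes θ a b ≤ (foolingSet θ a b).card := by
  let F₁ := (Finset.Icc (θ - b) (min θ a)).image fun c => (c, θ - c)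
  -- For `θ = 0` the half-open upper end makes this empty, so the truncated `θ - 1` does no harm.
  let F₀ := (Finset.Ico (θ - (b + 1)) (min θ (a + 1))).image fun c => (c, θ - 1 - c)
  have h₁ : F₁.card = min θ a + 1 - (θ - b) := by
    rw [Finset.card_image_of_injective _ fun c c' h => (Prod.ext_iff.1 h).1, Nat.card_Icc]
  have h₀ : F₀.card = min θ (a + 1) - (θ - (b + 1)) := by
    rw [Finset.card_image_of_injective _ fun c c' h => (Prod.ext_iff.1 h).1, Nat.card_Ico]
  have hdisj : Disjoint F₁ F₀ := by
    rw [Finset.disjoint_left]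
    rintro ⟨c, d⟩ hc hc'
    simp only [F₁, F₀, Finset.mem_image, Finset.mem_Icc, Finset.mem_Ico, Prod.mk.injEq] at hc hc'
    obtain ⟨c₁, hc₁, rfl, rfl⟩ := hc
    obtain ⟨c₀, hc₀, h, h'⟩ := hc'
    omega
  calc outcomes θ a b ≤ (F₁ ∪ F₀).card := by
        rw [Finset.card_union_of_disjoint hdisj, h₁, h₀, outcomes, Nat.card_Icc, Nat.card_Ico]
        omega
    _ ≤ _ := Finset.card_le_card fun ⟨c, d⟩ hc => by
        simp only [F₁, F₀, foolingSet, Finset.mem_union, Finset.mem_image, Finset.mem_Icc,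
          Finset.mem_Ico, Prod.mk.injEq, Finset.mem_filter, Finset.mem_product,
          Finset.mem_range] at hc ⊢
        rcases hc with ⟨c₁, hc₁, rfl, rfl⟩ | ⟨c₁, hc₁, rfl, rfl⟩ <;> omega

/-- If `q` has total `θ`, the mixed totals force `p` to dominate `q` coordinatewise, while the total
of `p` is at most `θ`. If `q` has total `θ - 1`, all inequalities reverse. -/
lemma eq_of_mem_foolingSet {θ a b : ℕ} {p q : ℕ × ℕ} (hp : p ∈ foolingSet θ a b)
    (hq : q ∈ foolingSet θ a b)
    (h₁ : θ ≤ q.1 + q.2 ↔ θ ≤ p.1 + q.2) (h₂ : θ ≤ q.1 + q.2 ↔ θ ≤ q.1 + p.2) : p = q := by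
  simp only [foolingSet, Finset.mem_filter] at hp hq
  refine Prod.ext ?_ ?_ <;> omega

lemma exists_sum_eq {V : Type*} {l : V → ℕ} (hl : ∀ v, 1 ≤ l v) (A : Finset V) {a : ℕ}
    (ha : a ≤ maxSum l A) : ∃ y : (v : V) → Fin (l v), ∑ v ∈ A, (y v : ℕ) = a := by
  classical
  induction A using Finset.induction_on generalizing a with
  | empty =>
    refine ⟨fun v => ⟨0, hl v⟩, ?_⟩
    simp only [maxSum, Finset.sum_empty] at ha ⊢
    omega
  | insert v A hv ih =>
    rw [maxSum, Finset.sum_insert hv] at ha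
    obtain ⟨y, hy⟩ := ih (a := a - min a (l v - 1)) (by rw [maxSum]; omega)
    have := hl v
    refine ⟨Function.update y v ⟨min a (l v - 1), by omega⟩, ?_⟩
    rw [Finset.sum_insert hv, Function.update_self, Finset.sum_congr rfl fun w hw => by
      rw [Function.update_of_ne (ne_of_mem_of_not_mem hw hv)], hy]
    simp only
    omega

variable {V : Type*} [Fintype V] [DecidableEq V] {G : SimpleGraph V} {l : V → ℕ} {N : ℕ}

lemma maxSum_add_compl (A : Finset V) :
    maxSum l A + maxSum l Aᶜ = maxSum l Finset.univ :=
  Finset.sum_add_sum_compl A _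

lemma eq_of_mem_edgeSide_of_notMem {i j : V} {e : Sym2 V} (he : e ∈ G.edgeSet) {v w : V}
    (hv : v ∈ e) (hw : w ∈ e) (hvA : v ∈ edgeSide G i j) (hwA : w ∉ edgeSide G i j) :
    e = s(i, j) := by
  have hne : v ≠ w := fun h => hwA (h ▸ hvA)
  have hvw : e = s(v, w) := (Sym2.mem_and_mem_iff hne).1 ⟨hv, hw⟩
  by_contra h
  refine hwA (mem_edgeSide.2 ((mem_edgeSide.1 hvA).trans (SimpleGraph.Adj.reachable ?_)))
  rw [SimpleGraph.deleteEdges_adj, Set.mem_singleton_iff, ← hvw]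
  exact ⟨by rwa [hvw] at he, h⟩

lemma Strategy.outcomes_pow_le (hG : G.IsTree) (hl : ∀ v, 1 ≤ l v) {θ : ℕ}
    (hθ : θ ≤ maxSum l Finset.univ + 1) (S : Strategy G l N) (hS : S.Computes (sumThreshold θ))
    {i j : V} (h : G.Adj i j) :
    outcomes θ (maxSum l (edgeSide G i j)) (maxSum l (edgeSide G i j)ᶜ) ^ N ≤
      2 ^ S.cost ⟨s(i, j), h⟩ := by
  set A := edgeSide G i j with hA
  set F := foolingSet θ (maxSum l A) (maxSum l Aᶜ) with hF
  have hmem : ∀ p : F, p.1.1 ≤ maxSum l A ∧ p.1.2 ≤ maxSum l Aᶜ := fun p => by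
    have := p.2
    simp only [hF, foolingSet, Finset.mem_filter, Finset.mem_product, Finset.mem_range] at this
    omega
  choose ya hya using fun p : F => exists_sum_eq hl A (hmem p).1
  choose yb hyb using fun p : F => exists_sum_eq hl Aᶜ (hmem p).2
  let x : (Fin N → F) → BlockInput l N := fun w v k => if v ∈ A then ya (w k) v else yb (w k) v
  have hsum : ∀ w w' k, sumThreshold θ (fun u => (if u ∈ A then x w u else x w' u) k) =
      decide (θ ≤ (w k).1.1 + (w' k).1.2) := by
    intro w w' k
    rw [sumThreshold, ← Finset.sum_add_sum_compl A]
    congr 3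
    · rw [← hya]
      exact Finset.sum_congr rfl fun v hv => by simp [x, hv]
    · rw [← hyb]
      exact Finset.sum_congr rfl fun v hv => by simp [x, Finset.mem_compl.1 hv]
  have hdiag : ∀ w k, sumThreshold θ (fun u => x w u k) =
      decide (θ ≤ (w k).1.1 + (w k).1.2) := by
    intro w k
    rw [← hsum]
    simp
  have hcut : ∀ e' : G.edgeSet, ∀ v ∈ e'.1, ∀ w ∈ e'.1, v ∈ A → w ∉ A →
      e' = ⟨s(i, j), h⟩ := fun e' v hv w hw hvA hwA =>
    Subtype.ext (eq_of_mem_edgeSide_of_notMem e'.2 hv hw hvA hwA)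
  calc _ ≤ F.card ^ N := Nat.pow_le_pow_left (outcomes_le_card_foolingSet (by
          rwa [maxSum_add_compl])) N
    _ = Fintype.card (Fin N → F) := by simp
    _ ≤ _ := S.card_le_two_pow_cost _ x fun w w' hww => by
        funext k
        -- Both hybrids are needed: `w` on `A` with `w'` off it, and the reverse.
        have h1 := S.computes_hybrid hS (· ∈ A) (left_mem_edgeSide i j)
          (right_notMem_edgeSide hG h) hcut hww k
        have h2 := S.computes_hybrid hS (· ∈ A) (left_mem_edgeSide i j)
          (right_notMem_edgeSide hG h) hcut hww.symm k
        simp only [hsum, hdiag, decide_eq_decide] at h1 h2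
        exact Subtype.ext (eq_of_mem_foolingSet (w k).2 (w' k).2 h1.2 h2.1)

end Fooling

/-! ### The optimal protocol on a rooted tree -/

section Protocol

namespace Rooting

variable {V : Type*} [Fintype V] [DecidableEq V] {G : SimpleGraph V} (R : Rooting G)
  {l : V → ℕ} {N : ℕ} (θ : ℕ)

/-- The sum of the measurements at and below `v`. -/
def partialSum (v : V) (x : BlockInput l N) (k : Fin N) : ℕ := ∑ u ∈ R.below v, (x u k : ℕ)

/-- The partial sum, truncated so that all values that force `Π_θ = 1` are identified, and so are
all values that force `Π_θ = 0`. -/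
def truncSum (v : V) (x : BlockInput l N) (k : Fin N) : ℕ :=
  min θ (max (R.partialSum v x k) (θ - (maxSum l (R.below v)ᶜ + 1)))

/-- The positions at which the truncated partial sums `c` at `v` do not determine `Π_θ`. -/
def undecided (l : V → ℕ) (v : V) (c : Fin N → ℕ) : List (Fin N) :=
  (List.finRange N).filter fun k => c k ∈ Finset.Ico (θ - maxSum l (R.below v)ᶜ) θ

/-- The values of `Π_θ` at the undecided positions. -/
def reply (v : V) (x : BlockInput l N) : List Bool :=
  (R.undecided θ l v (R.truncSum θ v x)).map fun k => sumThreshold θ fun u => x u k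

lemma maxSum_below_add (v : V) :
    maxSum l (R.below v) + maxSum l (R.below v)ᶜ = maxSum l Finset.univ :=
  maxSum_add_compl _

omit [Fintype V] [DecidableEq V] in
lemma sum_le_maxSum (A : Finset V) (x : BlockInput l N) (k : Fin N) :
    ∑ u ∈ A, (x u k : ℕ) ≤ maxSum l A :=
  Finset.sum_le_sum fun u _ => by have := (x u k).2; omega

lemma truncSum_mem (hθ : θ ≤ maxSum l Finset.univ + 1) (v : V) (x : BlockInput l N) (k : Fin N) :
    R.truncSum θ v x k ∈
      Finset.Icc (θ - (maxSum l (R.below v)ᶜ + 1)) (min θ (maxSum l (R.below v))) := by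
  have h1 := R.maxSum_below_add (l := l) v
  have h2 : R.partialSum v x k ≤ maxSum l (R.below v) := sum_le_maxSum _ x k
  rw [Finset.mem_Icc, truncSum]
  omega

lemma sumThreshold_of_decided {v : V} {x : BlockInput l N} {k : Fin N}
    (h : R.truncSum θ v x k ∉ Finset.Ico (θ - maxSum l (R.below v)ᶜ) θ) :
    sumThreshold θ (fun u => x u k) = decide (θ ≤ R.truncSum θ v x k) := by
  rw [sumThreshold, ← Finset.sum_add_sum_compl (R.below v), decide_eq_decide]
  have h1 : ∑ u ∈ (R.below v)ᶜ, (x u k : ℕ) ≤ maxSum l (R.below v)ᶜ := sum_le_maxSum _ x k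
  rw [Finset.mem_Ico, truncSum, partialSum] at h
  rw [truncSum, partialSum]
  omega

/-- Truncation composes. If some child's sum reaches `θ`, or is too small for `θ` to be reachable,
the same holds at `v`; otherwise the truncated sums of the children are exact and can be added. -/
lemma truncSum_congr {v : V} {x y : BlockInput l N} (hxy : x v = y v)
    (h : ∀ c, c ≠ R.root → R.parent c = v → R.truncSum θ c x = R.truncSum θ c y) :
    R.truncSum θ v x = R.truncSum θ v y := by
  funext k
  let C := Finset.univ.filter fun c => c ≠ R.root ∧ R.parent c = v
  have hC : ∀ c ∈ C, R.truncSum θ c x k = R.truncSum θ c y k := fun c hc => by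
    rw [Finset.mem_filter] at hc
    rw [h c hc.2.1 hc.2.2]
  have hrec : ∀ z : BlockInput l N,
      R.partialSum v z k = z v k + ∑ c ∈ C, R.partialSum c z k := fun z =>
    R.sum_below (fun u => z u k) v
  have hmax : maxSum l (R.below v) = (l v - 1) + ∑ c ∈ C, maxSum l (R.below c) :=
    R.sum_below (fun u => l u - 1) v
  have hle : ∀ z : BlockInput l N, ∀ c ∈ C, R.partialSum c z k ≤ R.partialSum v z k :=
    fun z c hc => by
      have := Finset.single_le_sum (f := fun c => R.partialSum c z k)
        (fun _ _ => Nat.zero_le _) hc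
      have := hrec z
      omega
  have hge : ∀ z : BlockInput l N, ∀ c ∈ C, R.partialSum v z k + maxSum l (R.below v)ᶜ ≤
      R.partialSum c z k + maxSum l (R.below c)ᶜ := fun z c hc => by
    have h1 := hrec z
    rw [← Finset.add_sum_erase C _ hc] at h1 hmax
    have h2 : ∑ c ∈ C.erase c, R.partialSum c z k ≤ ∑ c ∈ C.erase c, maxSum l (R.below c) :=
      Finset.sum_le_sum fun c _ => sum_le_maxSum _ z k
    have h3 := R.maxSum_below_add (l := l) v
    have h4 := R.maxSum_below_add (l := l) c
    have h5 := (z v k).2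
    omega
  by_cases h1 : ∃ c ∈ C, θ ≤ R.partialSum c x k
  · obtain ⟨c, hc, h1⟩ := h1
    have h2 := hC c hc
    have h3 := hle x c hc
    have h4 := hle y c hc
    simp only [truncSum] at h2 ⊢
    omega
  by_cases h2 : ∃ c ∈ C, R.partialSum c x k + maxSum l (R.below c)ᶜ < θ
  · obtain ⟨c, hc, h2⟩ := h2
    have h3 := hC c hc
    have h4 := hge x c hc
    have h5 := hge y c hc
    simp only [truncSum] at h3 ⊢
    omega
  have heq : R.partialSum v x k = R.partialSum v y k := by
    rw [hrec, hrec, hxy]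
    congr 1
    refine Finset.sum_congr rfl fun c hc => ?_
    have h3 := hC c hc
    have h4 : ¬ θ ≤ R.partialSum c x k := fun h => h1 ⟨c, hc, h⟩
    have h5 : ¬ R.partialSum c x k + maxSum l (R.below c)ᶜ < θ := fun h => h2 ⟨c, hc, h⟩
    simp only [truncSum] at h3
    omega
  simp only [truncSum, heq]

/-- What a node has heard from its children and from its parent determines `Π_θ`. -/
lemma sumThreshold_congr {v : V} {x y : BlockInput l N} (hxy : x v = y v)
    (h : ∀ c, c ≠ R.root → R.parent c = v → R.truncSum θ c x = R.truncSum θ c y)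
    (hv : v ≠ R.root → R.reply θ v x = R.reply θ v y) (k : Fin N) :
    sumThreshold θ (fun u => x u k) = sumThreshold θ fun u => y u k := by
  have ht := R.truncSum_congr θ hxy h
  by_cases hk : R.truncSum θ v x k ∈ Finset.Ico (θ - maxSum l (R.below v)ᶜ) θ
  · by_cases hr : v = R.root
    · subst hr
      -- Nothing lies outside the root's set, so no value is undecided there and the root needs no
      -- reply.
      rw [R.below_root, Finset.mem_Ico] at hk
      simp only [maxSum, Finset.compl_univ, Finset.sum_empty] at hk
      omega
    · have := hv hr
      rw [reply, reply, ← ht, List.map_inj_left] at this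
      exact this k (by simpa [undecided] using hk)
  · rw [R.sumThreshold_of_decided θ hk]
    rw [ht] at hk ⊢
    rw [R.sumThreshold_of_decided θ hk]

lemma reply_congr {v : V} {x y : BlockInput l N} (ht : R.truncSum θ v x = R.truncSum θ v y)
    (h : ∀ k, sumThreshold θ (fun u => x u k) = sumThreshold θ fun u => y u k) :
    R.reply θ v x = R.reply θ v y := by
  rw [reply, reply, ht]
  exact List.map_congr_left fun k _ => h k

lemma length_reply (v : V) (x : BlockInput l N) :
    (R.reply θ v x).length = (R.undecided θ l v (R.truncSum θ v x)).length :=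
  List.length_map _

lemma card_below_lt {v : V} (hv : v ≠ R.root) :
    (R.below v).card < (R.below (R.parent v)).card := by
  have h := R.sum_below (fun _ => 1) (R.parent v)
  simp only [← Finset.card_eq_sum_ones] at h
  have := Finset.single_le_sum (f := fun c => (R.below c).card) (fun _ _ => Nat.zero_le _)
    (show v ∈ Finset.univ.filter fun c => c ≠ R.root ∧ R.parent c = R.parent v by simpa using hv)
  omega

/-- The endpoint of `e` that is further away from the root. -/
noncomputable def child (e : G.edgeSet) : V := (R.exists_child e).choose

lemma child_ne_root (e : G.edgeSet) : R.child e ≠ R.root := (R.exists_child e).choose_spec.1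

lemma edge_eq (e : G.edgeSet) : e.1 = s(R.child e, R.parent (R.child e)) :=
  (R.exists_child e).choose_spec.2

lemma child_injective : Function.Injective R.child := fun e e' h =>
  Subtype.ext (by rw [R.edge_eq e, R.edge_eq e', h])

lemma exists_edge {v : V} (hv : v ≠ R.root) :
    ∃ e : G.edgeSet, R.child e = v ∧ v ∈ e.1 ∧ R.parent v ∈ e.1 :=
  ⟨⟨s(v, R.parent v), R.adj v hv⟩,
    (R.child_unique _ _ hv (R.child_ne_root _) (R.edge_eq ⟨s(v, R.parent v), R.adj v hv⟩)).symm,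
    by simp⟩

variable {R θ} {E : V → BlockInput l N → List Bool}
  (hE : ∀ v x y, E v x <+: E v y → R.truncSum θ v x = R.truncSum θ v y)
  (hE' : ∀ v x y, R.truncSum θ v x = R.truncSum θ v y → E v x = E v y)

-- Prefix-freeness separates the codeword from the reply that follows it.
include hE in
lemma truncSum_eq_of_append_eq {v : V} {x y : BlockInput l N} {r r' : List Bool}
    (h : E v x ++ r = E v y ++ r') : R.truncSum θ v x = R.truncSum θ v y := by
  rcases List.prefix_or_prefix_of_prefix (List.prefix_append (E v x) r)
    (h ▸ List.prefix_append (E v y) r') with h | h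
  · exact hE v x y h
  · exact (hE v y x h).symm

include hE hE'

/-- The truncated partial sums can be sent towards the root. -/
lemma realizable_up (s : Finset V)
    (hs : ∀ v, v ≠ R.root → R.parent v ∈ s → v ∈ s) :
    Realizable fun (e : G.edgeSet) x => if R.child e ∈ s then E (R.child e) x else [] := by
  classical
  induction s using Finset.induction_on_max_value (fun v => (R.below v).card) with
  | empty => simpa using realizable_nil
  | insert a s ha hmax ih =>
    have ih := ih fun v hv hp => by
      refine (Finset.mem_insert.1 (hs v hv (Finset.mem_insert_of_mem hp))).resolve_left ?_
      rintro rfl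
      exact (hmax _ hp).not_gt (R.card_below_lt hv)
    by_cases har : a = R.root
    · refine (congrArg _ ?_).mp ih
      funext e x
      have : R.child e ≠ a := har ▸ R.child_ne_root e
      simp [Finset.mem_insert, this]
    · obtain ⟨e, rfl, hae, -⟩ := R.exists_edge har
      refine (congrArg _ ?_).mp (ih.append_message e hae (E (R.child e)) ?_ ?_)
      · funext e' x
        by_cases he : e' = e
        · subst he
          simp [ha]
        · have : R.child e' ≠ R.child e := fun h => he (R.child_injective h)
          simp [he, this]
      -- Since `a` has the largest set below it, its children have already reported.
      · refine fun x y hxy hT => hE' _ _ _ (R.truncSum_congr θ hxy fun c hc hp => ?_)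
        obtain ⟨e', rfl, -, hpe⟩ := R.exists_edge hc
        have hcs : R.child e' ∈ s := by
          refine (Finset.mem_insert.1 (hs _ hc (by simp [hp]))).resolve_left fun h => ?_
          have := R.card_below_lt hc
          rw [hp, h] at this
          exact this.false
        have := hT e' (hp ▸ hpe)
        simp only [hcs, if_true] at this
        exact hE _ _ _ (this ▸ List.prefix_rfl)
      · exact fun x y _ h => hE' _ _ _ (hE _ _ _ h)

/-- After that, the replies can be sent away from the root. -/
lemma realizable_down (s : Finset V)
    (hs : ∀ v ∈ s, v ≠ R.root → R.parent v ≠ R.root → R.parent v ∈ s) :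
    Realizable fun (e : G.edgeSet) x =>
      E (R.child e) x ++ if R.child e ∈ s then R.reply θ (R.child e) x else [] := by
  classical
  induction s using Finset.induction_on_min_value (fun v => (R.below v).card) with
  | empty => simpa using realizable_up hE hE' Finset.univ (fun _ _ _ => Finset.mem_univ _)
  | insert a s ha hmin ih =>
    have ih := ih fun v hv hvr hp => by
      refine (Finset.mem_insert.1 (hs v (Finset.mem_insert_of_mem hv) hvr hp)).resolve_left ?_
      intro h
      exact (hmin _ hv).not_gt (h ▸ R.card_below_lt hvr)
    by_cases har : a = R.root
    · refine (congrArg _ ?_).mp ih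
      funext e x
      have : R.child e ≠ a := har ▸ R.child_ne_root e
      simp [Finset.mem_insert, this]
    · obtain ⟨e, rfl, -, hpe⟩ := R.exists_edge har
      refine (congrArg _ ?_).mp (ih.append_message e hpe (R.reply θ (R.child e)) ?_ ?_)
      · funext e' x
        by_cases he : e' = e
        · subst he
          simp [ha]
        · have : R.child e' ≠ R.child e := fun h => he (R.child_injective h)
          simp [he, this]
      · intro x y hxy hT
        have hC : ∀ c, c ≠ R.root → R.parent c = R.parent (R.child e) →
            R.truncSum θ c x = R.truncSum θ c y := by
          intro c hc hp
          obtain ⟨e', rfl, -, hpe'⟩ := R.exists_edge hc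
          exact truncSum_eq_of_append_eq hE (hT e' (hp ▸ hpe'))
        -- The parent knows the function block from its children's codewords and, unless it is the
        -- root, from the reply it has already received.
        refine R.reply_congr θ (hC _ har rfl) (R.sumThreshold_congr θ hxy hC fun hw => ?_)
        have hws := (Finset.mem_insert.1 (hs _ (Finset.mem_insert_self _ _) har hw)).resolve_left
          fun h => by
            have := R.card_below_lt har
            rw [h] at this
            exact this.false
        obtain ⟨e', he', hwe, -⟩ := R.exists_edge hw
        have h := hT e' hwe
        simp only [he', hws, if_true] at h
        rw [hE' _ _ _ (truncSum_eq_of_append_eq hE h)] at h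
        exact List.append_cancel_left h
      · intro x y hT h
        -- The reply's length is fixed by the codeword already sent, so it needs no end marker.
        refine h.eq_of_length ?_
        rw [length_reply, length_reply, truncSum_eq_of_append_eq hE hT]

lemma exists_computes_of_code : ∃ S : Strategy G l N, S.Computes (sumThreshold θ) ∧
    ∀ e x, S.bits e x = (E (R.child e) x).length +
      (R.undecided θ l (R.child e) (R.truncSum θ (R.child e) x)).length := by
  have h := realizable_down hE hE' Finset.univ (fun _ _ _ _ => Finset.mem_univ _)
  simp only [Finset.mem_univ, if_true] at h
  obtain ⟨S, hS, hS'⟩ := h.exists_computes (f := sumThreshold θ) (by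
    intro x y v hxy hT
    refine R.sumThreshold_congr θ hxy (fun c hc hp => ?_) fun hv => ?_
    · obtain ⟨e', rfl, -, hpe'⟩ := R.exists_edge hc
      exact truncSum_eq_of_append_eq hE (hT e' (hp ▸ hpe'))
    · obtain ⟨e', rfl, hve, -⟩ := R.exists_edge hv
      have h := hT e' hve
      rw [hE' _ _ _ (truncSum_eq_of_append_eq hE h)] at h
      exact List.append_cancel_left h)
  exact ⟨S, hS, fun e x => by rw [hS', List.length_append, length_reply]⟩

omit hE hE'

/-- The weight `2 ^ u` is a product over positions. A single position contributes 1 for each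
truncated value and 1 more for each undecided one, which is `outcomes`. -/
lemma sum_two_pow_undecided (v : V) :
    ∑ c ∈ Fintype.piFinset (fun _ : Fin N =>
        Finset.Icc (θ - (maxSum l (R.below v)ᶜ + 1)) (min θ (maxSum l (R.below v)))),
      2 ^ (R.undecided θ l v c).length =
    outcomes θ (maxSum l (R.below v)) (maxSum l (R.below v)ᶜ) ^ N := by
  set a := maxSum l (R.below v)
  set b := maxSum l (R.below v)ᶜ
  have hpow : ∀ c : Fin N → ℕ, 2 ^ (R.undecided θ l v c).length =
      ∏ k, if c k ∈ Finset.Ico (θ - b) θ then 2 else 1 := by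
    intro c
    rw [Finset.prod_ite, Finset.prod_const, Finset.prod_const_one, mul_one]
    rfl
  have hone : ∑ c ∈ Finset.Icc (θ - (b + 1)) (min θ a),
      (if c ∈ Finset.Ico (θ - b) θ then 2 else 1) = outcomes θ a b := by
    have h : ∀ c, (if c ∈ Finset.Ico (θ - b) θ then 2 else 1) =
        1 + if c ∈ Finset.Ico (θ - b) θ then 1 else 0 := fun c => by split_ifs <;> rfl
    rw [Finset.sum_congr rfl fun c _ => h c, Finset.sum_add_distrib, ← Finset.card_eq_sum_ones,
      ← Finset.card_filter, outcomes]
    congr 2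
    ext c
    simp only [Finset.mem_filter, Finset.mem_Icc, Finset.mem_Ico]
    omega
  rw [Finset.sum_congr rfl fun c _ => hpow c, ← Finset.prod_univ_sum (fun _ : Fin N =>
    Finset.Icc (θ - (b + 1)) (min θ a)) fun _ c => if c ∈ Finset.Ico (θ - b) θ then 2 else 1,
    Finset.prod_congr rfl fun _ _ => hone]
  simp

-- The first summand pays for the header: at most `N` positions are undecided, and `N < 2 ^ (Nat.log
-- 2 N + 1)`. The reply uses up exactly the bits saved by the codeword.
variable (R) in
lemma exists_computes (hθ : θ ≤ maxSum l Finset.univ + 1) (N : ℕ) :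
    ∃ S : Strategy G l N, S.Computes (sumThreshold θ) ∧ ∀ e, S.cost e ≤ (Nat.log 2 N + 1) +
      Nat.clog 2 (outcomes θ (maxSum l (R.below (R.child e)))
        (maxSum l (R.below (R.child e))ᶜ) ^ N) := by
  choose enc hlen hpre using fun v => Finset.exists_prefix_code
    (Fintype.piFinset (fun _ : Fin N =>
        Finset.Icc (θ - (maxSum l (R.below v)ᶜ + 1)) (min θ (maxSum l (R.below v)))))
    (fun c => (R.undecided θ l v c).length)
    (K := Nat.clog 2 (outcomes θ (maxSum l (R.below v)) (maxSum l (R.below v)ᶜ) ^ N))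
    (m := Nat.log 2 N + 1)
    (fun c _ => lt_of_le_of_lt ((List.length_filter_le _ _).trans_eq List.length_finRange)
      (Nat.lt_pow_succ_log_self one_lt_two N))
    ((sum_two_pow_undecided v).trans_le (Nat.le_pow_clog one_lt_two _))
  have hmem : ∀ v x, R.truncSum θ v x ∈ Fintype.piFinset (fun _ : Fin N =>
        Finset.Icc (θ - (maxSum l (R.below v)ᶜ + 1)) (min θ (maxSum l (R.below v)))) :=
    fun v x => Fintype.mem_piFinset.2 fun k => R.truncSum_mem θ hθ v x k
  obtain ⟨S, hS, hbits⟩ := exists_computes_of_code (R := R) (θ := θ)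
    (E := fun v x => enc v (R.truncSum θ v x))
    (fun v x y h => hpre v _ (hmem v x) _ (hmem v y) h) (fun v x y h => congrArg (enc v) h)
  refine ⟨S, hS, fun e => Finset.sup_le fun x _ => ?_⟩
  rw [hbits, hlen _ _ (hmem _ x)]

end Rooting

end Protocol

/-! ### Passing to the limit -/

section Rate

lemma thresholdRate_eq {V : Type*} [Fintype V] [DecidableEq V] {l : V → ℕ} {θ : ℕ}
    (hθ : θ ≤ maxSum l Finset.univ + 1) (A : Finset V) :
    thresholdRate l θ A = Real.logb 2 (outcomes θ (maxSum l A) (maxSum l Aᶜ)) := by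
  have h := maxSum_add_compl (l := l) A
  rw [← h] at hθ
  rw [outcomes_eq hθ, thresholdRate, ← h]
  push_cast [Nat.cast_sub hθ]
  congr 4
  ring

lemma outcomes_comm {θ a b : ℕ} (h : θ ≤ a + b + 1) : outcomes θ a b = outcomes θ b a := by
  rw [outcomes_eq h, outcomes_eq (by omega), min_comm a b, add_comm a b]

lemma tendsto_div_of_pow_bounds {M : ℕ} (hM : 0 < M) (c : ℕ → ℕ) (hlow : ∀ N, M ^ N ≤ 2 ^ c N)
    (hup : ∀ N, c N ≤ (Nat.log 2 N + 1) + Nat.clog 2 (M ^ N)) :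
    Tendsto (fun N => (c N : ℝ) / N) atTop (𝓝 (Real.logb 2 M)) := by
  have hM' : (0 : ℝ) < M := by exact_mod_cast hM
  have hlogpow : ∀ N : ℕ, Real.logb 2 ((M : ℝ) ^ N) = N * Real.logb 2 M := fun N =>
    Real.logb_pow _ _ _
  have hlow' : ∀ N : ℕ, N * Real.logb 2 M ≤ c N := fun N => by
    rw [← hlogpow, Real.logb_le_iff_le_rpow one_lt_two (pow_pos hM' N), Real.rpow_natCast]
    exact_mod_cast hlow N
  have hup' : ∀ N : ℕ, (c N : ℝ) ≤ N * Real.logb 2 M + (Real.logb 2 N + 2) := fun N => by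
    have h1 : (c N : ℝ) ≤ (Nat.log 2 N + 1) + Nat.clog 2 (M ^ N) := by exact_mod_cast hup N
    have h2 : (Nat.log 2 N : ℝ) ≤ Real.logb 2 N := by
      exact_mod_cast Real.natLog_le_logb N 2
    have h3 : (Nat.clog 2 (M ^ N) : ℝ) ≤ Real.logb 2 ((M : ℝ) ^ N) + 1 := by
      have h4 : 0 ≤ Real.logb 2 ((M ^ N : ℕ) : ℝ) :=
        Real.logb_nonneg one_lt_two (by exact_mod_cast Nat.one_le_pow _ _ hM)
      have h5 := Real.natCeil_logb_natCast 2 (M ^ N)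
      rw [← h5]
      exact_mod_cast (Nat.ceil_lt_add_one h4).le
    rw [hlogpow] at h3
    linarith
  have herr : Tendsto (fun N : ℕ => (Real.logb 2 N + 2) / N) atTop (𝓝 0) := by
    have h1 : Tendsto (fun N : ℕ => Real.log N / N) atTop (𝓝 0) :=
      (Real.isLittleO_log_id_atTop.tendsto_div_nhds_zero).comp tendsto_natCast_atTop_atTop
    have h2 := (h1.div_const (Real.log 2)).add (tendsto_const_div_atTop_nhds_zero_nat 2)
    rw [zero_div, add_zero] at h2
    refine h2.congr fun N => ?_
    rw [Real.logb]
    ring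
  have hlim : Tendsto (fun N : ℕ => Real.logb 2 M + (Real.logb 2 N + 2) / N) atTop
      (𝓝 (Real.logb 2 M)) := by
    simpa using herr.const_add (Real.logb 2 M)
  refine tendsto_of_tendsto_of_tendsto_of_le_of_le' tendsto_const_nhds hlim ?_ ?_
  · filter_upwards [eventually_gt_atTop 0] with N hN
    have hN' : (0 : ℝ) < N := by exact_mod_cast hN
    rw [le_div_iff₀ hN', mul_comm]
    exact hlow' N
  · filter_upwards [eventually_gt_atTop 0] with N hN
    have hN' : (0 : ℝ) < N := by exact_mod_cast hN
    rw [div_le_iff₀ hN', add_mul, div_mul_cancel₀ _ hN'.ne', mul_comm (Real.logb 2 M)]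
    exact hup' N

lemma Rooting.outcomes_child {V : Type*} [Fintype V] [DecidableEq V] {G : SimpleGraph V}
    (R : Rooting G) (hG : G.IsTree) {l : V → ℕ} {θ : ℕ} (hθ : θ ≤ maxSum l Finset.univ + 1)
    {i j : V} (h : G.Adj i j) :
    outcomes θ (maxSum l (R.below (R.child ⟨s(i, j), h⟩)))
      (maxSum l (R.below (R.child ⟨s(i, j), h⟩))ᶜ) =
    outcomes θ (maxSum l (edgeSide G i j)) (maxSum l (edgeSide G i j)ᶜ) := by
  rw [R.below_eq _ (R.child_ne_root _)]
  have he := R.edge_eq ⟨s(i, j), h⟩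
  rcases Sym2.eq_iff.1 he with ⟨h1, h2⟩ | ⟨h1, h2⟩
  · rw [← h2, ← h1]
  · rw [← h1, ← h2, edgeSide_swap hG h, compl_compl]
    exact outcomes_comm (by rwa [add_comm (maxSum l _), maxSum_add_compl])

end Rate

theorem mainTheorem10 {V : Type*} [Fintype V] [DecidableEq V] (G : SimpleGraph V) (hG : G.IsTree)
    (l : V → ℕ) (hl : ∀ v, 1 ≤ l v) (θ : ℕ) (hθ : θ ≤ maxSum l Finset.univ + 1) :
    (∀ (i j : V) (h : G.Adj i j),
      Tendsto (fun N : ℕ => (minCost G l (sumThreshold θ) ⟨s(i, j), h⟩ N : ℝ) / (N : ℝ)) atTop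
        (𝓝 (thresholdRate l θ (edgeSide G i j)))) ∧
    ∃ S : (N : ℕ) → Strategy G l N,
      (∀ N, (S N).Computes (sumThreshold θ)) ∧
      ∀ (i j : V) (h : G.Adj i j),
        Tendsto (fun N : ℕ => ((S N).cost ⟨s(i, j), h⟩ : ℝ) / (N : ℝ)) atTop
          (𝓝 (thresholdRate l θ (edgeSide G i j))) := by
  obtain ⟨R⟩ := nonempty_rooting hG
  choose S hS hcost using R.exists_computes hθ
  have hpos : ∀ i j, 0 < outcomes θ (maxSum l (edgeSide G i j)) (maxSum l (edgeSide G i j)ᶜ) :=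
    fun i j => outcomes_pos (by rwa [maxSum_add_compl])
  refine ⟨fun i j h => ?_, S, hS, fun i j h => ?_⟩
  · rw [thresholdRate_eq hθ]
    refine tendsto_div_of_pow_bounds (hpos i j) _ (fun N => ?_) fun N => ?_
    -- The protocol shows that the set of costs is nonempty, so the infimum is attained by a correct
    -- strategy and is not the default value 0.
    · obtain ⟨S', hS', hc⟩ := Nat.sInf_mem
        (s := {c | ∃ S : Strategy G l N, S.Computes (sumThreshold θ) ∧ S.cost ⟨s(i, j), h⟩ = c})
        ⟨_, S N, hS N, rfl⟩
      rw [minCost, ← hc]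
      exact S'.outcomes_pow_le hG hl hθ hS' h
    · rw [← R.outcomes_child hG hθ h]
      have hmin : minCost G l (sumThreshold θ) ⟨s(i, j), h⟩ N ≤ (S N).cost ⟨s(i, j), h⟩ :=
        Nat.sInf_le ⟨S N, hS N, rfl⟩
      exact hmin.trans (hcost N _)
  · rw [thresholdRate_eq hθ]
    refine tendsto_div_of_pow_bounds (hpos i j) _
      (fun N => (S N).outcomes_pow_le hG hl hθ (hS N) h) fun N => ?_
    rw [← R.outcomes_child hG hθ h]
    exact hcost N _
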